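/- Let all random variables below be defined on a probability space $(\Omega,\mathcal F,\mathbb P)$. Let $\cdots\le t_{-1}\le t_0\le 0<t_1\le t_2\le\cdots$ be the points of a (locally finite) point process on $\mathbb R$, let $N(t)$ be the number of points in $(0,t]$, $t\ge 0$, and let $\tau_k=t_k-t_{k-1}$ be the durations. Let $\mu\neq 0$, and let $(e_k)_{k\ge1}$ be i.i.d. random variables with mean zero and finite variance $\sigma_e^2$ ($\sigma_e\ge0$), independent of the process $N(\cdot)$. Let $(\eta_k)_{k\ge1}$ be random variables (which may depend on $N$) such that, as $n\to\infty$, $$n^{-1/2}\sum_{k=1}^{[n\,\cdot]}\eta_k\Rightarrow 0$$ weakly in the space $\mathcal D([0,\infty))$ of càdlàg functions with Skorohod's $J_1$ topology. Put $$y(t)=\mu N(t)+\sum_{k=1}^{N(t)}(e_k+\eta_k),\qquad t\ge0.$$ Assume that for some $\lambda>0$, some $\gamma\in[1/2,1)$ and some random variable $A$ that is not almost surely zero, $$n^{-\gamma}\sum_{k=1}^{n}(\tau_k-1/\lambda)\xrightarrow{d}A .$$ If $\gamma>1/2$, then $$n^{-\gamma}\,(y(n)-\lambda\mu n)\xrightarrow{d}-\mu\lambda^{1+\gamma}A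 .$$ If $\gamma=1/2$, then $$n^{-1/2}\,(y(n)-\lambda\mu n)\xrightarrow{d}-\mu\lambda^{3/2}A+\sqrt{\lambda}\,\sigma_e Z ,$$ where $Z$ is a standard Gaussian random variable independent of $A$. -/

import Mathlib

open MeasureTheory ProbabilityTheory Filter Topology
open scoped NNReal

/-- The space `D([0,∞))` of real-valued càdlàg functions on `[0,∞)`: right-continuous functions
that have a left limit at every point. -/
structure CadlagSpace where
  toFun : ℝ≥0 → ℝ
  rightCont : ∀ s : ℝ≥0, ContinuousWithinAt toFun (Set.Ioi s) s
  leftLim : ∀ s : ℝ≥0, ∃ l : ℝ, Tendsto toFun (𝓝[<] s) (𝓝 l)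

namespace CadlagSpace

instance : CoeFun CadlagSpace (fun _ => ℝ≥0 → ℝ) := ⟨toFun⟩

/-- The zero function. -/
instance : Zero CadlagSpace :=
  ⟨⟨fun _ => 0, fun _ => continuousWithinAt_const, fun _ => ⟨0, tendsto_const_nhds⟩⟩⟩

/-- Basic `J₁`-neighbourhood of `x`: the functions `y` for which there is a time change `θ`
(an increasing bijection of `[0,∞)`) that is uniformly `ε`-close to the identity and such that
`y ∘ θ` is `ε`-close to `x` on `[0,T]`. -/
def skorokhodNhd (x : CadlagSpace) (T : ℝ≥0) (ε : ℝ) : Set CadlagSpace :=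
  {y | ∃ θ : ℝ≥0 ≃o ℝ≥0,
    (∀ s : ℝ≥0, |(θ s : ℝ) - (s : ℝ)| < ε) ∧ ∀ s : ℝ≥0, s ≤ T → |y (θ s) - x s| < ε}

theorem skorokhodNhd_mono (x : CadlagSpace) {T T' : ℝ≥0} {ε ε' : ℝ} (hT : T ≤ T') (hε : ε' ≤ ε) :
    skorokhodNhd x T' ε' ⊆ skorokhodNhd x T ε := by
  rintro y ⟨θ, h1, h2⟩
  exact ⟨θ, fun s => (h1 s).trans_le hε, fun s hs => (h2 s (hs.trans hT)).trans_le hε⟩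

/-- Skorokhod's `J₁` topology on `D([0,∞))`: a set is open if it contains a basic
`J₁`-neighbourhood of each of its points. -/
instance : TopologicalSpace CadlagSpace where
  IsOpen U := ∀ x ∈ U, ∃ T : ℝ≥0, ∃ ε : ℝ, 0 < ε ∧ skorokhodNhd x T ε ⊆ U
  isOpen_univ := fun _ _ => ⟨0, 1, one_pos, Set.subset_univ _⟩
  isOpen_inter := by
    rintro U V hU hV x ⟨hxU, hxV⟩
    obtain ⟨T, ε, hε, h⟩ := hU x hxU
    obtain ⟨T', ε', hε', h'⟩ := hV x hxV
    refine ⟨max T T', min ε ε', lt_min hε hε', Set.subset_inter ?_ ?_⟩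
    · exact (skorokhodNhd_mono x (le_max_left _ _) (min_le_left _ _)).trans h
    · exact (skorokhodNhd_mono x (le_max_right _ _) (min_le_right _ _)).trans h'
  isOpen_sUnion := by
    rintro S hS x ⟨U, hU, hxU⟩
    obtain ⟨T, ε, hε, h⟩ := hS U hU x hxU
    exact ⟨T, ε, hε, h.trans (Set.subset_sUnion_of_mem hU)⟩

/-- The Borel σ-algebra of the `J₁` topology. -/
instance : MeasurableSpace CadlagSpace := borel CadlagSpace

instance : BorelSpace CadlagSpace := ⟨rfl⟩

/-- For a real sequence `a`, the càdlàg step function `s ↦ a ⌊n s⌋`. -/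
noncomputable def ofSeq (a : ℕ → ℝ) (n : ℕ) : CadlagSpace where
  toFun s := a ⌊(n : ℝ≥0) * s⌋₊
  rightCont s := by
    have hc : ContinuousAt (fun u : ℝ≥0 => (n : ℝ≥0) * u) s := by fun_prop
    have hlt : (n : ℝ≥0) * s < (⌊(n : ℝ≥0) * s⌋₊ : ℝ≥0) + 1 := Nat.lt_floor_add_one _
    have hev : ∀ᶠ u in 𝓝[>] s, a ⌊(n : ℝ≥0) * u⌋₊ = a ⌊(n : ℝ≥0) * s⌋₊ := by
      filter_upwards [nhdsWithin_le_nhds (hc.eventually_lt_const hlt), self_mem_nhdsWithin]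
        with u hu hsu
      congr 1
      refine (Nat.floor_eq_iff (zero_le)).2 ⟨?_, hu⟩
      exact (Nat.floor_le (zero_le)).trans (mul_le_mul_right (le_of_lt hsu) _)
    exact tendsto_const_nhds.congr' (hev.mono fun u hu => hu.symm)
  leftLim s := by
    refine ⟨a (⌈(n : ℝ≥0) * s⌉₊ - 1), ?_⟩
    have hc : ContinuousAt (fun u : ℝ≥0 => (n : ℝ≥0) * u) s := by fun_prop
    have hev : ∀ᶠ u in 𝓝[<] s, a ⌊(n : ℝ≥0) * u⌋₊ = a (⌈(n : ℝ≥0) * s⌉₊ - 1) := by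
      rcases Nat.eq_zero_or_pos ⌈(n : ℝ≥0) * s⌉₊ with h0 | hpos
      · filter_upwards [self_mem_nhdsWithin] with u hu
        have h1 : (n : ℝ≥0) * s = 0 := le_antisymm (Nat.ceil_eq_zero.1 h0) (zero_le)
        have h2 : (n : ℝ≥0) * u = 0 :=
          le_antisymm ((mul_le_mul_right (le_of_lt hu) _).trans h1.le) (zero_le)
        simp [h1, h2]
      · have hlt : ((⌈(n : ℝ≥0) * s⌉₊ - 1 : ℕ) : ℝ≥0) < (n : ℝ≥0) * s :=
          Nat.lt_ceil.1 (by omega)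
        have hn : (0 : ℝ≥0) < n := by
          rcases Nat.eq_zero_or_pos n with h | h
          · subst h; simp at hpos
          · exact_mod_cast h
        filter_upwards [nhdsWithin_le_nhds (hc.eventually_const_lt hlt), self_mem_nhdsWithin]
          with u hu hus
        congr 1
        refine (Nat.floor_eq_iff (zero_le)).2 ⟨hu.le, ?_⟩
        have h3 : (n : ℝ≥0) * u < (n : ℝ≥0) * s := mul_lt_mul_of_pos_left hus hn
        have h4 : (n : ℝ≥0) * s ≤ (⌈(n : ℝ≥0) * s⌉₊ : ℝ≥0) := Nat.le_ceil _
        have h5 : ((⌈(n : ℝ≥0) * s⌉₊ - 1 : ℕ) : ℝ≥0) + 1 = (⌈(n : ℝ≥0) * s⌉₊ : ℝ≥0) := by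
          exact_mod_cast Nat.sub_add_cancel hpos
        rw [h5]
        exact h3.trans_le h4
    exact tendsto_const_nhds.congr' (hev.mono fun u hu => hu.symm)

end CadlagSpace

/-- The partial-sum process `s ↦ n^{-1/2} ∑_{k=1}^{[n s]} η_k`, as an element of `D([0,∞))`. -/
noncomputable def partialSumProcess {Ω : Type*} (η : ℕ → Ω → ℝ) (n : ℕ) (ω : Ω) : CadlagSpace :=
  CadlagSpace.ofSeq (fun m => (n : ℝ) ^ (-(1 / 2) : ℝ) * ∑ k ∈ Finset.Icc 1 m, η k ω) n

/-- `t` enumerates the points of a (locally finite) point process on the real line: the `t k` are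
random variables and, almost surely,
`⋯ ≤ t (-1) ≤ t 0 ≤ 0 < t 1 ≤ t 2 ≤ ⋯`, without accumulation of points at a finite time. -/
structure IsPointSequence {Ω : Type*} [MeasurableSpace Ω] (P : Measure Ω) (t : ℤ → Ω → ℝ) :
    Prop where
  measurable : ∀ k, Measurable (t k)
  monotone : ∀ᵐ ω ∂P, Monotone fun k => t k ω
  origin : ∀ᵐ ω ∂P, t 0 ω ≤ 0 ∧ 0 < t 1 ω
  tendsto_atTop : ∀ᵐ ω ∂P, Tendsto (fun k => t k ω) atTop atTop
  tendsto_atBot : ∀ᵐ ω ∂P, Tendsto (fun k => t k ω) atBot atBot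

/-- `N(s)`: the number of points in `(0,s]`. -/
noncomputable def countingProcess {Ω : Type*} (t : ℤ → Ω → ℝ) (s : ℝ) (ω : Ω) : ℕ :=
  Set.ncard {k : ℤ | 0 < t k ω ∧ t k ω ≤ s}

/-- The duration `τ_k = t_k - t_{k-1}`. -/
def duration {Ω : Type*} (t : ℤ → Ω → ℝ) (k : ℤ) (ω : Ω) : ℝ :=
  t k ω - t (k - 1) ω

/-- The log price `y(s) = μ N(s) + ∑_{k=1}^{N(s)} (e_k + η_k)`. -/
noncomputable def logPrice {Ω : Type*} (μ : ℝ) (t : ℤ → Ω → ℝ) (e η : ℕ → Ω → ℝ) (s : ℝ) (ω : Ω) :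
    ℝ :=
  μ * (countingProcess t s ω : ℝ)
    + ∑ k ∈ Finset.Icc 1 (countingProcess t s ω), (e k ω + η k ω)

/-! The proof inverts the counting process. Since N(s) ≥ m exactly when t_m ≤ s
(`IsPointSequence.ae_le_countingProcess_iff`), the event n^{-γ}(N(n) - λn) < x is, for large n, the
event t_m > n with m = ⌈λn + x n^γ⌉. The durations telescope to t_m - t_0, the term t_0 disappears
under scaling, and m^{-γ}(n - m/λ) → -x λ^{-(1+γ)}. Hence n^{-γ}(N(n) - λn) converges to -λ^{1+γ}A
(`tendstoInDistribution_countingProcess`), and in particular N(n)/n → λ in probability.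

The price error splits into μ(N(n) - λn), a sum of e_k and a sum of η_k, the sums running up to
N(n). The η-sum is o(√n) in probability, because a J₁-continuous localized supremum dominates it
(`tendstoInMeasure_randomSum_of_partialSumProcess`). In the e-sum, independence and Chebyshev's
inequality allow N(n) to be replaced by ⌊λn⌋ at cost o(√n) (`tendstoInMeasure_randomSum_sub`), after
which the central limit theorem applies.

If γ > 1/2, both sums vanish under the scaling n^{-γ}. If γ = 1/2, the e-sum up to the deterministic
index ⌊λn⌋ is independent of N(n), so characteristic functions multiply and the two limits add
independently; Slutsky's lemma absorbs the errors. -/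

/-! ### Convergence in distribution and in probability on the real line -/

section RealDistribution

variable {Ω Ω' : Type*} [MeasurableSpace Ω] {P : Measure Ω} [IsProbabilityMeasure P]
  [MeasurableSpace Ω'] {P' : Measure Ω'} [IsProbabilityMeasure P']

/-- A real random variable has only countably many atoms, so every nonempty open interval
contains a point that is not an atom. -/
theorem exists_mem_Ioo_measure_eq_zero {Z : Ω' → ℝ} (hZ : AEMeasurable Z P') {a b : ℝ}
    (hab : a < b) : ∃ c ∈ Set.Ioo a b, P' {ω | Z ω = c} = 0 := by
  have hc : Set.Countable {c : ℝ | 0 < P' {ω | Z ω = c}} := by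
    refine Measure.countable_meas_pos_of_disjoint_iUnion₀ (fun c => ?_) ?_
    · exact nullMeasurableSet_eq_fun hZ aemeasurable_const
    · intro c d hcd
      refine Disjoint.aedisjoint ?_
      rw [Set.disjoint_left]
      intro ω h1 h2
      exact hcd (h1.symm.trans h2)
  obtain ⟨c, hc1, hc2⟩ := (hc.dense_compl ℝ).exists_mem_open isOpen_Ioo (Set.nonempty_Ioo.2 hab)
  exact ⟨c, hc2, by simpa using hc1⟩

theorem measureReal_map_Ico {Z : Ω' → ℝ} (hZ : AEMeasurable Z P') {a b : ℝ} (hab : a ≤ b) :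
    (P'.map Z).real (Set.Ico a b) = P'.real {ω | Z ω < b} - P'.real {ω | Z ω < a} := by
  rw [map_measureReal_apply_of_aemeasurable hZ measurableSet_Ico, eq_sub_iff_add_eq,
    ← measureReal_union₀ (nullMeasurableSet_lt hZ aemeasurable_const)]
  · congr 1
    ext ω
    simp only [Set.mem_union, Set.mem_preimage, Set.mem_Ico, Set.mem_ofPred_eq]
    constructor
    · rintro (h | h)
      · exact h.2
      · exact h.trans_le hab
    · intro h
      rcases le_or_gt a (Z ω) with h' | h'
      · exact Or.inl ⟨h', h⟩
      · exact Or.inr h'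
  · refine Disjoint.aedisjoint ?_
    rw [Set.disjoint_left]
    intro ω h1 h2
    exact (not_lt.2 h1.1) h2

/-- Convergence of distribution functions at the non-atoms of the limit implies convergence in
distribution. -/
theorem tendstoInDistribution_of_tendsto_measure_lt {X : ℕ → Ω → ℝ} {Z : Ω' → ℝ}
    (hX : ∀ n, AEMeasurable (X n) P) (hZ : AEMeasurable Z P')
    (h : ∀ x : ℝ, P' {ω | Z ω = x} = 0 →
      Tendsto (fun n => P.real {ω | X n ω < x}) atTop (𝓝 (P'.real {ω | Z ω < x}))) :
    TendstoInDistribution X atTop Z (fun _ => P) P' := by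
  refine ⟨hX, hZ, ?_⟩
  -- Intersecting half-open intervals creates no new endpoints, so they form a π-system even with
  -- endpoints restricted to non-atoms; density of the non-atoms makes them fine enough to determine
  -- weak convergence.
  let S : Set (Set ℝ) := {s | ∃ a b : ℝ, a ≤ b ∧ P' {ω | Z ω = a} = 0 ∧
    P' {ω | Z ω = b} = 0 ∧ s = Set.Ico a b}
  have hS : IsPiSystem S := by
    rintro _ ⟨a, b, hab, ha, hb, rfl⟩ _ ⟨c, d, hcd, hc, hd, rfl⟩ hne
    rw [Set.Ico_inter_Ico] at hne ⊢
    refine ⟨a ⊔ c, b ⊓ d, (Set.nonempty_Ico.1 hne).le, ?_, ?_, rfl⟩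
    · rcases max_choice a c with h | h <;> rw [h] <;> assumption
    · rcases min_choice b d with h | h <;> rw [h] <;> assumption
  refine hS.tendsto_probabilityMeasure_of_tendsto_of_mem ?_ ?_ ?_
  · rintro _ ⟨a, b, -, -, -, rfl⟩
    exact measurableSet_Ico
  · intro u hu x hx
    obtain ⟨ε, hε, hball⟩ := Metric.isOpen_iff.1 hu x hx
    obtain ⟨a, ha, ha'⟩ := exists_mem_Ioo_measure_eq_zero hZ (sub_lt_self x hε)
    obtain ⟨b, hb, hb'⟩ := exists_mem_Ioo_measure_eq_zero hZ (lt_add_of_pos_right x hε)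
    refine ⟨Set.Ico a b, ⟨a, b, (ha.2.trans hb.1).le, ha', hb', rfl⟩,
      Ico_mem_nhds ha.2 hb.1, fun y hy => hball ?_⟩
    rw [Real.ball_eq_Ioo]
    exact ⟨ha.1.trans_le hy.1, hy.2.trans hb.2⟩
  · rintro _ ⟨a, b, hab, ha, hb, rfl⟩
    rw [← NNReal.tendsto_coe]
    have h1 := (h b hb).sub (h a ha)
    rw [← measureReal_map_Ico hZ hab] at h1
    exact h1.congr fun n => (measureReal_map_Ico (hX n) hab).symm

theorem MeasureTheory.TendstoInDistribution.comp_tendsto {X : ℕ → Ω → ℝ} {Z : Ω' → ℝ}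
    (h : TendstoInDistribution X atTop Z (fun _ => P) P') {m : ℕ → ℕ}
    (hm : Tendsto m atTop atTop) :
    TendstoInDistribution (fun n => X (m n)) atTop Z (fun _ => P) P' :=
  ⟨fun n => h.forall_aemeasurable (m n), h.aemeasurable_limit, h.tendsto.comp hm⟩

theorem tendstoInMeasure_const_of_tendsto {a : ℕ → ℝ} {c : ℝ} (ha : Tendsto a atTop (𝓝 c)) :
    TendstoInMeasure P (fun n (_ : Ω) => a n) atTop (fun _ => c) :=
  tendstoInMeasure_of_tendsto_ae (fun _ => aestronglyMeasurable_const) (ae_of_all _ fun _ => ha)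

theorem MeasureTheory.TendstoInDistribution.const_mul_of_tendsto {X : ℕ → Ω → ℝ} {Z : Ω' → ℝ}
    (h : TendstoInDistribution X atTop Z (fun _ => P) P') {a : ℕ → ℝ} {c : ℝ}
    (ha : Tendsto a atTop (𝓝 c)) :
    TendstoInDistribution (fun n ω => a n * X n ω) atTop (fun ω => c * Z ω) (fun _ => P) P' :=
  h.continuous_comp_prodMk_of_tendstoInMeasure_const (g := fun x : ℝ × ℝ => x.2 * x.1)
    (by fun_prop) (tendstoInMeasure_const_of_tendsto ha) (fun _ => aemeasurable_const)

/-- Subtracting the moving threshold (Slutsky) reduces to the fixed set (0, ∞), whose frontier {0}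
is null for the law of Z - c; the portmanteau theorem then applies. The moving threshold is what the
inversion of N requires. -/
theorem MeasureTheory.TendstoInDistribution.tendsto_measure_gt {X : ℕ → Ω → ℝ} {Z : Ω' → ℝ}
    (h : TendstoInDistribution X atTop Z (fun _ => P) P') {a : ℕ → ℝ} {c : ℝ}
    (ha : Tendsto a atTop (𝓝 c)) (hc : P' {ω | Z ω = c} = 0) :
    Tendsto (fun n => P.real {ω | a n < X n ω}) atTop (𝓝 (P'.real {ω | c < Z ω})) := by
  have h1 : TendstoInDistribution (fun n ω => X n ω - a n) atTop (fun ω => Z ω - c)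
      (fun _ => P) P' :=
    h.continuous_comp_prodMk_of_tendstoInMeasure_const (g := fun x : ℝ × ℝ => x.1 - x.2)
      (by fun_prop) (tendstoInMeasure_const_of_tendsto ha) (fun _ => aemeasurable_const)
  have h2 := ProbabilityMeasure.tendsto_measure_of_null_frontier_of_tendsto' h1.tendsto
    (E := Set.Ioi (0 : ℝ)) (by
      rw [frontier_Ioi]
      simp only [ProbabilityMeasure.coe_mk]
      rw [Measure.map_apply_of_aemeasurable h1.aemeasurable_limit (measurableSet_singleton _)]
      convert hc using 2
      ext ω
      simp [sub_eq_zero])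
  simp only [ProbabilityMeasure.coe_mk] at h2
  rw [Measure.map_apply_of_aemeasurable h1.aemeasurable_limit measurableSet_Ioi] at h2
  have h3 := (ENNReal.tendsto_toReal (measure_ne_top _ _)).comp h2
  convert h3 using 2 with n
  · simp only [Function.comp]
    rw [Measure.map_apply_of_aemeasurable (h1.forall_aemeasurable n) measurableSet_Ioi]
    simp [Measure.real, Set.preimage]
  · simp [Measure.real, Set.preimage]

/-- A null sequence times a sequence that converges in distribution tends to `0` in probability. -/
theorem MeasureTheory.TendstoInDistribution.tendstoInMeasure_mul_zero {X : ℕ → Ω → ℝ} {Z : Ω' → ℝ}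
    (h : TendstoInDistribution X atTop Z (fun _ => P) P') {a : ℕ → ℝ}
    (ha : Tendsto a atTop (𝓝 0)) :
    TendstoInMeasure P (fun n ω => a n * X n ω) atTop (fun _ => 0) := by
  have h1 := h.const_mul_of_tendsto ha
  have h2 := h1.continuous_comp (g := fun x : ℝ => |x|) (by fun_prop)
  rw [tendstoInMeasure_iff_measureReal_norm]
  intro ε hε
  -- The limit is identically 0, so ε / 2 is not an atom; halving also turns the event `ε ≤ |·|`
  -- into a strict inequality.
  have h3 := TendstoInDistribution.tendsto_measure_gt h2 (a := fun _ => ε / 2) (c := ε / 2)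
    tendsto_const_nhds (by
      have : {ω : Ω' | ((fun x : ℝ => |x|) ∘ fun ω => 0 * Z ω) ω = ε / 2} = ∅ := by
        ext ω
        simp [(half_pos hε).ne]
      rw [this]; simp)
  have h4 : {ω : Ω' | ε / 2 < ((fun x : ℝ => |x|) ∘ fun ω => 0 * Z ω) ω} = ∅ := by
    ext ω
    simp [(half_pos hε).le]
  rw [h4, measureReal_empty] at h3
  refine squeeze_zero (fun n => measureReal_nonneg) (fun n => ?_) h3
  refine measureReal_mono fun ω hω => ?_
  simp only [Set.mem_ofPred_eq, sub_zero, Real.norm_eq_abs, Function.comp] at hω ⊢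
  linarith

/-- Sums of independent sequences that converge in distribution converge in distribution to the
sum of independent copies of the limits. -/
theorem MeasureTheory.TendstoInDistribution.add_of_indepFun {X Y : ℕ → Ω → ℝ} {U V : Ω' → ℝ}
    (hX : TendstoInDistribution X atTop U (fun _ => P) P')
    (hY : TendstoInDistribution Y atTop V (fun _ => P) P')
    (hXY : ∀ n, IndepFun (X n) (Y n) P) (hUV : IndepFun U V P') :
    TendstoInDistribution (fun n ω => X n ω + Y n ω) atTop (fun ω => U ω + V ω)
      (fun _ => P) P' := by
  refine ⟨fun n => (hX.forall_aemeasurable n).add (hY.forall_aemeasurable n),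
    hX.aemeasurable_limit.add hY.aemeasurable_limit, ?_⟩
  refine ProbabilityMeasure.tendsto_of_tendsto_charFun fun s => ?_
  have h1 := ProbabilityMeasure.tendsto_iff_tendsto_charFun.1 hX.tendsto s
  have h2 := ProbabilityMeasure.tendsto_iff_tendsto_charFun.1 hY.tendsto s
  simp only [ProbabilityMeasure.coe_mk] at h1 h2 ⊢
  rw [hUV.charFun_map_fun_add_eq_mul hX.aemeasurable_limit hY.aemeasurable_limit]
  refine (h1.mul h2).congr fun n => ?_
  rw [(hXY n).charFun_map_fun_add_eq_mul (hX.forall_aemeasurable n) (hY.forall_aemeasurable n)]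
  rfl

theorem MeasureTheory.TendstoInMeasure.add_of_zero {X Y : ℕ → Ω → ℝ}
    (hX : TendstoInMeasure P X atTop (fun _ => 0))
    (hY : TendstoInMeasure P Y atTop (fun _ => 0)) :
    TendstoInMeasure P (fun n ω => X n ω + Y n ω) atTop (fun _ => 0) := by
  rw [tendstoInMeasure_iff_measureReal_norm] at hX hY ⊢
  intro ε hε
  have h := (hX _ (half_pos hε)).add (hY _ (half_pos hε))
  rw [add_zero] at h
  refine squeeze_zero (fun n => measureReal_nonneg) (fun n => ?_) h
  refine (measureReal_mono ?_).trans (measureReal_union_le _ _)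
  intro ω hω
  simp only [Set.mem_ofPred_eq, sub_zero, Real.norm_eq_abs, Set.mem_union] at hω ⊢
  by_contra! hcon
  linarith [abs_add_le (X n ω) (Y n ω)]

end RealDistribution

/-! ### Duality between points and counts -/

section Counting

variable {Ω : Type*} [MeasurableSpace Ω] {P : Measure Ω} {t : ℤ → Ω → ℝ}

/-- The duality between a point sequence and its counting process. -/
theorem IsPointSequence.ae_le_countingProcess_iff (ht : IsPointSequence P t) :
    ∀ᵐ ω ∂P, ∀ (s : ℝ) (m : ℕ), 1 ≤ m → (m ≤ countingProcess t s ω ↔ t m ω ≤ s) := by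
  filter_upwards [ht.monotone, ht.origin, ht.tendsto_atTop] with ω hmono h0 htop s m hm
  have hset : {k : ℤ | 0 < t k ω ∧ t k ω ≤ s} = {k : ℤ | 1 ≤ k ∧ t k ω ≤ s} := by
    ext k
    simp only [Set.mem_ofPred_eq, and_congr_left_iff]
    intro _
    constructor
    · intro hk
      by_contra! hlt
      have := hmono (show k ≤ 0 by omega)
      simp only at this
      linarith [h0.1]
    · intro hk
      have := hmono hk
      simp only at this
      linarith [h0.2]
  obtain ⟨K, hK⟩ := (htop.eventually_gt_atTop s).exists
  have hbound : ∀ j : ℤ, s < t j ω → {k : ℤ | 1 ≤ k ∧ t k ω ≤ s} ⊆ Set.Ioo 0 j := by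
    rintro j hj k ⟨hk1, hk2⟩
    refine ⟨by omega, ?_⟩
    by_contra! hle
    have := hmono hle
    simp only at this
    linarith
  rw [countingProcess, hset]
  constructor
  · intro hle
    -- If t_m > s, the counted indices lie strictly between 0 and m, so there are at most m - 1 of
    -- them.
    by_contra! hlt
    have h1 := Set.ncard_le_ncard (hbound m hlt) (Set.finite_Ioo _ _)
    rw [← Finset.coe_Ioo, Set.ncard_coe_finset, Int.card_Ioo] at h1
    omega
  · intro hle
    have h1 : Set.Icc (1 : ℤ) m ⊆ {k : ℤ | 1 ≤ k ∧ t k ω ≤ s} := by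
      rintro k ⟨hk1, hk2⟩
      exact ⟨hk1, (hmono hk2).trans hle⟩
    -- Finiteness, from t_k → ∞, is essential here: `Set.ncard` of an infinite set is 0.
    have h2 := Set.ncard_le_ncard h1 ((Set.finite_Ioo _ _).subset (hbound K hK))
    rw [← Finset.coe_Icc, Set.ncard_coe_finset, Int.card_Icc] at h2
    omega

theorem measurable_countingProcess (ht : ∀ k, Measurable (t k)) (s : ℝ) :
    Measurable (countingProcess t s) := by
  have h : Measurable fun ω => (∑' k : ℤ, Set.indicator {ω | 0 < t k ω ∧ t k ω ≤ s}
      (fun _ => (1 : ENNReal)) ω) := by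
    refine Measurable.tsum fun k => measurable_const.indicator ?_
    exact (measurableSet_lt measurable_const (ht k)).inter
      (measurableSet_le (ht k) measurable_const)
  -- The identity holds for every ω, not just almost surely: for infinitely many points both
  -- `Set.ncard` and `ENNReal.toReal` return 0.
  have h2 : countingProcess t s = fun ω => ⌊(∑' k : ℤ, Set.indicator {ω | 0 < t k ω ∧ t k ω ≤ s}
      (fun _ => (1 : ENNReal)) ω).toReal⌋₊ := by
    funext ω
    have h3 : (∑' k : ℤ, Set.indicator {ω | 0 < t k ω ∧ t k ω ≤ s} (fun _ => (1 : ENNReal)) ω)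
        = ((Set.encard {k : ℤ | 0 < t k ω ∧ t k ω ≤ s} : ℕ∞) : ENNReal) := by
      rw [← ENNReal.tsum_set_one, tsum_subtype _ fun _ => (1 : ENNReal)]
      rfl
    rw [h3, countingProcess, Set.ncard]
    generalize Set.encard {k : ℤ | 0 < t k ω ∧ t k ω ≤ s} = c
    induction c using ENat.recTopCoe with
    | top => simp
    | coe a => simp
  rw [h2]
  exact Nat.measurable_floor.comp h.ennreal_toReal

end Counting

/-! ### From the durations to the counting process -/

section Inversion

variable {Ω Ω' : Type*} [MeasurableSpace Ω] {P : Measure Ω} [IsProbabilityMeasure P]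
  [MeasurableSpace Ω'] {P' : Measure Ω'} [IsProbabilityMeasure P'] {t : ℤ → Ω → ℝ}
  {lam γ : ℝ} {A : Ω' → ℝ}

theorem tendsto_natCast_rpow_neg {r : ℝ} (hr : 0 < r) :
    Tendsto (fun n : ℕ => (n : ℝ) ^ (-r)) atTop (𝓝 0) :=
  (tendsto_rpow_neg_atTop hr).comp tendsto_natCast_atTop_atTop

theorem sum_duration_sub {α : Type*} (t : ℤ → α → ℝ) (c : ℝ) (n : ℕ) (ω : α) :
    ∑ k ∈ Finset.Icc 1 n, (duration t (k : ℤ) ω - c) = t n ω - t 0 ω - n * c := by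
  induction n with
  | zero => simp
  | succ n ih =>
    rw [Finset.sum_Icc_succ_top (by omega), ih, duration]
    push_cast
    rw [add_sub_cancel_right]
    ring

/-- The centred points have the same limit as the centred sums of durations. -/
theorem tendstoInDistribution_points (ht : IsPointSequence P t) (hγ : 0 < γ)
    (hτ : TendstoInDistribution
      (fun (n : ℕ) (ω : Ω) =>
        (n : ℝ) ^ (-γ) * ∑ k ∈ Finset.Icc 1 n, (duration t (k : ℤ) ω - 1 / lam))
      atTop A (fun _ => P) P') :
    TendstoInDistribution (fun (n : ℕ) (ω : Ω) => (n : ℝ) ^ (-γ) * (t n ω - n / lam))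
      atTop A (fun _ => P) P' := by
  have h0 : TendstoInMeasure P (fun (n : ℕ) ω => (n : ℝ) ^ (-γ) * t 0 ω) atTop
      (fun _ => 0) :=
    (tendstoInDistribution_const (ht.measurable 0).aemeasurable).tendstoInMeasure_mul_zero
      (tendsto_natCast_rpow_neg hγ)
  have h1 := hτ.add_of_tendstoInMeasure_const h0
    fun n => ((ht.measurable 0).const_mul _).aemeasurable
  convert h1 using 2 with n
  · ext ω
    simp only [Pi.add_apply, sum_duration_sub]
    ring
  · simp

theorem tendsto_natCeil_div {x : ℝ} (hlam : 0 < lam) (hγ1 : γ < 1) :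
    Tendsto (fun n : ℕ => (⌈lam * n + x * (n : ℝ) ^ γ⌉₊ : ℝ) / n) atTop (𝓝 lam) ∧
    Tendsto (fun n : ℕ => lam * n + x * (n : ℝ) ^ γ) atTop atTop := by
  have hlin : Tendsto (fun n : ℕ => lam + x * (n : ℝ) ^ (-(1 - γ))) atTop (𝓝 lam) := by
    simpa using (tendsto_natCast_rpow_neg (r := 1 - γ) (by linarith)).const_mul x |>.const_add lam
  have heq : ∀ᶠ n : ℕ in atTop, (lam + x * (n : ℝ) ^ (-(1 - γ))) * n
      = lam * n + x * (n : ℝ) ^ γ := by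
    filter_upwards [eventually_gt_atTop 0] with n hn
    have hn' : (0 : ℝ) < n := by exact_mod_cast hn
    have : (n : ℝ) ^ γ = (n : ℝ) ^ (-(1 - γ)) * n := by
      rw [← Real.rpow_add_one hn'.ne']
      congr 1
      ring
    rw [this]
    ring
  have htop : Tendsto (fun n : ℕ => lam * n + x * (n : ℝ) ^ γ) atTop atTop :=
    (hlin.pos_mul_atTop hlam tendsto_natCast_atTop_atTop).congr' heq
  refine ⟨?_, htop⟩
  have hup : Tendsto (fun n : ℕ => lam + x * (n : ℝ) ^ (-(1 - γ)) + 1 / n) atTop (𝓝 lam) := by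
    simpa using hlin.add tendsto_one_div_atTop_nhds_zero_nat
  refine tendsto_of_tendsto_of_tendsto_of_le_of_le' hlin hup ?_ ?_
  · filter_upwards [eventually_gt_atTop 0, heq] with n hn he
    have hn' : (0 : ℝ) < n := by exact_mod_cast hn
    rw [le_div_iff₀ hn', he]
    exact Nat.le_ceil _
  · filter_upwards [eventually_gt_atTop 0, heq, htop.eventually_ge_atTop 0] with n hn he h0
    have hn' : (0 : ℝ) < n := by exact_mod_cast hn
    rw [div_le_iff₀ hn', add_mul, he, one_div_mul_cancel hn'.ne']
    exact (Nat.ceil_lt_add_one h0).le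

/-- The deterministic thresholds obtained by inverting `x ↦ ⌈λ n + x n ^ γ⌉`. -/
theorem tendsto_inversion_threshold {x : ℝ} (hlam : 0 < lam) (hγ : 0 < γ) (hγ1 : γ < 1) :
    Tendsto (fun n : ℕ => (⌈lam * n + x * (n : ℝ) ^ γ⌉₊ : ℝ) ^ (-γ)
      * (n - ⌈lam * n + x * (n : ℝ) ^ γ⌉₊ / lam)) atTop (𝓝 (-x * lam ^ (-(1 + γ)))) := by
  obtain ⟨hdiv, htop⟩ := tendsto_natCeil_div (x := x) hlam hγ1
  set m : ℕ → ℕ := fun n => ⌈lam * n + x * (n : ℝ) ^ γ⌉₊ with hm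
  have h1 : Tendsto (fun n : ℕ => ((m n : ℝ) / n) ^ (-γ)) atTop (𝓝 (lam ^ (-γ))) :=
    hdiv.rpow_const (Or.inl hlam.ne')
  -- Rounding up costs at most 1, which is n^{-γ} after scaling.
  have h2 : Tendsto (fun n : ℕ => ((m n : ℝ) - lam * n) * (n : ℝ) ^ (-γ)) atTop (𝓝 x) := by
    have hup : Tendsto (fun n : ℕ => x + (n : ℝ) ^ (-γ)) atTop (𝓝 x) := by
      simpa using (tendsto_natCast_rpow_neg hγ).const_add x
    refine tendsto_of_tendsto_of_tendsto_of_le_of_le' tendsto_const_nhds hup ?_ ?_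
    · filter_upwards [eventually_gt_atTop 0] with n hn
      have hn' : (0 : ℝ) < n := by exact_mod_cast hn
      rw [Real.rpow_neg hn'.le, ← div_eq_mul_inv, le_div_iff₀ (by positivity)]
      linarith [Nat.le_ceil (lam * n + x * (n : ℝ) ^ γ)]
    · filter_upwards [eventually_gt_atTop 0, htop.eventually_ge_atTop 0] with n hn h0
      have hn' : (0 : ℝ) < n := by exact_mod_cast hn
      have hp : (0 : ℝ) < (n : ℝ) ^ γ := by positivity
      rw [Real.rpow_neg hn'.le, ← div_eq_mul_inv, div_le_iff₀ hp, add_mul,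
        inv_mul_cancel₀ hp.ne']
      linarith [Nat.ceil_lt_add_one h0]
  have h3 := (h1.mul h2).const_mul (-(1 / lam))
  have hlim : -(1 / lam) * (lam ^ (-γ) * x) = -x * lam ^ (-(1 + γ)) := by
    rw [show -(1 + γ) = -γ - 1 by ring, Real.rpow_sub_one hlam.ne']
    ring
  rw [hlim] at h3
  refine h3.congr' ?_
  filter_upwards [eventually_gt_atTop 0] with n hn
  have hn' : (0 : ℝ) < n := by exact_mod_cast hn
  rw [Real.div_rpow (Nat.cast_nonneg _) hn'.le]
  have hp : (0 : ℝ) < (n : ℝ) ^ (-γ) := by positivity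
  field_simp
  ring

/-- Convergence of the centred points implies convergence of the centred counting process. -/
theorem tendstoInDistribution_countingProcess (ht : IsPointSequence P t) (hlam : 0 < lam)
    (hγ : 0 < γ) (hγ1 : γ < 1)
    (hW : TendstoInDistribution (fun (n : ℕ) (ω : Ω) => (n : ℝ) ^ (-γ) * (t n ω - n / lam))
      atTop A (fun _ => P) P') :
    TendstoInDistribution
      (fun (n : ℕ) (ω : Ω) => (n : ℝ) ^ (-γ) * (countingProcess t (n : ℝ) ω - lam * n))
      atTop (fun ω => -lam ^ (1 + γ) * A ω) (fun _ => P) P' := by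
  have hNm : ∀ n : ℕ, Measurable fun ω => (countingProcess t (n : ℝ) ω : ℝ) := fun n =>
    (measurable_from_top (f := fun k : ℕ => (k : ℝ))).comp
      (measurable_countingProcess ht.measurable n)
  refine tendstoInDistribution_of_tendsto_measure_lt
    (fun n => (((hNm n).sub_const _).const_mul _).aemeasurable)
    (hW.aemeasurable_limit.const_mul _) fun x hx => ?_
  have hlp : (0 : ℝ) < lam ^ (1 + γ) := by positivity
  have hcancel : lam ^ (-(1 + γ)) * lam ^ (1 + γ) = 1 := by
    rw [← Real.rpow_add hlam]
    simp
  have hmul : ∀ a : ℝ, -x * lam ^ (-(1 + γ)) < a ↔ -lam ^ (1 + γ) * a < x := by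
    intro a
    rw [← mul_lt_mul_iff_left₀ hlp, mul_assoc, hcancel]
    constructor <;> intro h <;> linarith
  have hmul' : ∀ a : ℝ, a = -x * lam ^ (-(1 + γ)) ↔ -lam ^ (1 + γ) * a = x := by
    intro a
    constructor
    · rintro rfl
      linear_combination x * hcancel
    · intro h
      linear_combination (-a) * hcancel - lam ^ (-(1 + γ)) * h
  obtain ⟨-, htop⟩ := tendsto_natCeil_div (x := x) hlam hγ1
  have hmtop : Tendsto (fun n : ℕ => ⌈lam * n + x * (n : ℝ) ^ γ⌉₊) atTop atTop :=
    tendsto_nat_ceil_atTop.comp htop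
  -- The point limit is used along the subsequence of indices m = ⌈λn + x n^γ⌉; the threshold -x
  -- λ^{-(1+γ)} is a non-atom of A because x is one of -λ^{1+γ}A.
  have hmain := (hW.comp_tendsto hmtop).tendsto_measure_gt
    (tendsto_inversion_threshold (x := x) hlam hγ hγ1) (by simpa only [hmul'] using hx)
  simp only [hmul] at hmain
  refine hmain.congr' ?_
  filter_upwards [eventually_gt_atTop 0, hmtop.eventually_ge_atTop 1] with n hn hm1
  have hn' : (0 : ℝ) < n := by exact_mod_cast hn
  refine measureReal_congr ?_
  filter_upwards [ht.ae_le_countingProcess_iff] with ω hω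
  have h1 := hω n ⌈lam * n + x * (n : ℝ) ^ γ⌉₊ hm1
  have hmp : (0 : ℝ) < (⌈lam * n + x * (n : ℝ) ^ γ⌉₊ : ℝ) ^ (-γ) := by
    have : (0 : ℝ) < ⌈lam * n + x * (n : ℝ) ^ γ⌉₊ := by exact_mod_cast hm1
    positivity
  have hnp : (0 : ℝ) < (n : ℝ) ^ γ := by positivity
  refine propext ?_
  change (_ * _ < _ * _) ↔ (_ * _ < _)
  rw [mul_lt_mul_iff_right₀ hmp, sub_lt_sub_iff_right, ← not_le, ← h1, not_le, Nat.lt_ceil,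
    Real.rpow_neg hn'.le, inv_mul_lt_iff₀ hnp]
  constructor <;> intro h <;> linarith

end Inversion

/-! ### Sums of i.i.d. variables up to an independent random index -/

section RandomSums

variable {Ω Ω' : Type*} [MeasurableSpace Ω] {P : Measure Ω} [IsProbabilityMeasure P]
  [MeasurableSpace Ω'] {P' : Measure Ω'} [IsProbabilityMeasure P'] {ξ : ℕ → Ω → ℝ} {σ lam : ℝ}

theorem measurable_randomSum {α : Type*} [MeasurableSpace α] {ζ : ℕ → α → ℝ} {N : α → ℕ}
    (hζ : ∀ k, Measurable (ζ k)) (hN : Measurable N) :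
    Measurable fun ω => ∑ k ∈ Finset.range (N ω), ζ k ω :=
  (measurable_from_prod_countable_right (f := fun p : ℕ × α => ∑ k ∈ Finset.range p.1, ζ k p.2)
    fun n => Finset.measurable_sum (Finset.range n) fun k _ => hζ k).comp (hN.prodMk measurable_id)

/-- **Chebyshev's inequality** for the increments of a centred i.i.d. random walk. -/
theorem measureReal_le_abs_sum_sub_sum (hindep : iIndepFun ξ P)
    (hident : ∀ k, IdentDistrib (ξ k) (ξ 0) P P) (hsq : MemLp (ξ 0) 2 P)
    (hmean : ∫ ω, ξ 0 ω ∂P = 0) (hvar : variance (ξ 0) P = σ ^ 2) (m m₀ : ℕ) {d c : ℝ}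
    (hc : 0 < c) (hd : |(m : ℝ) - m₀| ≤ d) :
    P.real {ω | c ≤ |∑ k ∈ Finset.range m, ξ k ω - ∑ k ∈ Finset.range m₀, ξ k ω|}
      ≤ d * σ ^ 2 / c ^ 2 := by
  wlog hmm : m₀ ≤ m generalizing m m₀
  · have := this m₀ m (by rwa [abs_sub_comm]) (by omega)
    simpa only [abs_sub_comm] using this
  have hL : ∀ k, MemLp (ξ k) 2 P := fun k => (hident k).memLp_iff.2 hsq
  have hvarsum : variance (∑ k ∈ Finset.Ico m₀ m, ξ k) P = ((m : ℝ) - m₀) * σ ^ 2 := by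
    rw [IndepFun.variance_sum (fun k _ => hL k) fun i _ j _ hij => hindep.indepFun hij]
    rw [Finset.sum_congr rfl fun k _ => ((hident k).variance_eq.trans hvar)]
    simp [Nat.cast_sub hmm]
  have hmean' : ∫ ω, (∑ k ∈ Finset.Ico m₀ m, ξ k) ω ∂P = 0 := by
    simp only [Finset.sum_apply]
    rw [integral_finsetSum _ fun k _ => (hL k).integrable one_le_two]
    exact Finset.sum_eq_zero fun k _ => (hident k).integral_eq.trans hmean
  have h := meas_ge_le_variance_div_sq (memLp_finsetSum' (Finset.Ico m₀ m) fun k _ => hL k) hc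
  rw [hmean', hvarsum] at h
  rw [abs_of_nonneg (sub_nonneg.2 (Nat.cast_le.2 hmm))] at hd
  have h0 : 0 ≤ ((m : ℝ) - m₀) * σ ^ 2 / c ^ 2 := by
    have : (m₀ : ℝ) ≤ m := Nat.cast_le.2 hmm
    have := sub_nonneg.2 this
    positivity
  have h2 := ENNReal.toReal_mono ENNReal.ofReal_ne_top h
  rw [ENNReal.toReal_ofReal h0] at h2
  refine le_trans (le_of_eq ?_) (h2.trans (by gcongr))
  rw [Measure.real]
  congr 3
  ext ω
  simp [Finset.sum_Ico_eq_sub _ hmm]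

/-- Chebyshev's inequality at an independent random index. -/
theorem measureReal_le_abs_randomSum_sub_sum (hindep : iIndepFun ξ P)
    (hident : ∀ k, IdentDistrib (ξ k) (ξ 0) P P) (hsq : MemLp (ξ 0) 2 P)
    (hmean : ∫ ω, ξ 0 ω ∂P = 0) (hvar : variance (ξ 0) P = σ ^ 2) {N : Ω → ℕ}
    (hN : Measurable N) (hξN : IndepFun (fun ω k => ξ k ω) N P) (m₀ : ℕ) {d c : ℝ}
    (hc : 0 < c) (hd : 0 ≤ d) :
    P.real {ω | c ≤ |∑ k ∈ Finset.range (N ω), ξ k ω - ∑ k ∈ Finset.range m₀, ξ k ω|}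
      ≤ P.real {ω | d < |(N ω : ℝ) - m₀|} + d * σ ^ 2 / c ^ 2 := by
  classical
  -- The indices within d of m₀. On each event N = m with m in F, independence factors the
  -- probability and Chebyshev's bound is uniform in m, so summing P(N = m) ≤ 1 loses nothing.
  let F : Finset ℕ := (Finset.range (m₀ + ⌊d⌋₊ + 1)).filter fun m => |(m : ℝ) - m₀| ≤ d
  let B : ℕ → Set (ℕ → ℝ) := fun m =>
    {x | c ≤ |∑ k ∈ Finset.range m, x k - ∑ k ∈ Finset.range m₀, x k|}
  have hB : ∀ m, MeasurableSet (B m) := fun m => by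
    refine measurableSet_le measurable_const ?_
    fun_prop
  have hsub : {ω | c ≤ |∑ k ∈ Finset.range (N ω), ξ k ω - ∑ k ∈ Finset.range m₀, ξ k ω|}
      ⊆ {ω | d < |(N ω : ℝ) - m₀|} ∪
        ⋃ m ∈ F, ((fun ω k => ξ k ω) ⁻¹' B m ∩ N ⁻¹' {m}) := by
    intro ω hω
    rcases lt_or_ge d |(N ω : ℝ) - m₀| with h | h
    · exact Or.inl h
    · refine Or.inr (Set.mem_biUnion (x := N ω) ?_ ⟨hω, rfl⟩)
      simp only [F, Finset.coe_filter, Finset.mem_range]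
      refine ⟨?_, h⟩
      have h1 : (N ω : ℝ) ≤ m₀ + d := by linarith [(abs_le.1 h).2]
      have h2 : (N ω : ℝ) < (m₀ + ⌊d⌋₊ + 1 : ℕ) := by
        push_cast
        linarith [Nat.lt_floor_add_one d]
      exact_mod_cast h2
  refine (measureReal_mono hsub).trans ((measureReal_union_le _ _).trans ?_)
  gcongr
  refine (measureReal_biUnion_finset_le _ _).trans ?_
  have hterm : ∀ m ∈ F, P.real ((fun ω k => ξ k ω) ⁻¹' B m ∩ N ⁻¹' {m})
      ≤ d * σ ^ 2 / c ^ 2 * P.real (N ⁻¹' {m}) := by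
    intro m hm
    rw [Measure.real, hξN.measure_inter_preimage_eq_mul _ _ (hB m) (measurableSet_singleton m),
      ENNReal.toReal_mul]
    change P.real _ * P.real _ ≤ _
    gcongr
    exact measureReal_le_abs_sum_sub_sum hindep hident hsq hmean hvar m m₀ hc
      (Finset.mem_filter.1 hm).2
  refine (Finset.sum_le_sum hterm).trans ?_
  rw [← Finset.mul_sum]
  refine mul_le_of_le_one_right (by positivity) ?_
  rw [← measureReal_biUnion_finset]
  · exact measureReal_le_one
  · intro i _ j _ hij
    exact Disjoint.preimage N (Set.disjoint_singleton.2 hij)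
  · exact fun m _ => hN (measurableSet_singleton m)

/-- In a sum of i.i.d. centred variables up to an independent random index `N n ~ λ n`, the index
may be replaced by `⌊λ n⌋` (**Anscombe's theorem** for independent indices). -/
theorem tendstoInMeasure_randomSum_sub (hlam : 0 < lam) (hindep : iIndepFun ξ P)
    (hident : ∀ k, IdentDistrib (ξ k) (ξ 0) P P) (hsq : MemLp (ξ 0) 2 P)
    (hmean : ∫ ω, ξ 0 ω ∂P = 0) (hvar : variance (ξ 0) P = σ ^ 2) {N : ℕ → Ω → ℕ}
    (hN : ∀ n, Measurable (N n)) (hξN : ∀ n, IndepFun (fun ω k => ξ k ω) (N n) P)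
    (hNlim : TendstoInMeasure P (fun n ω => ((N n ω : ℝ) - lam * n) / n) atTop (fun _ => 0)) :
    TendstoInMeasure P (fun (n : ℕ) ω => (√(n : ℝ))⁻¹ * (∑ k ∈ Finset.range (N n ω), ξ k ω
      - ∑ k ∈ Finset.range ⌊lam * n⌋₊, ξ k ω)) atTop (fun _ => 0) := by
  rw [tendstoInMeasure_iff_measureReal_norm] at hNlim ⊢
  intro ε hε
  rw [Metric.tendsto_atTop']
  intro ρ hρ
  -- Chosen so that the Chebyshev term δσ²/ε² is below ρ / 2; the summand 1 covers σ = 0. Requiring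
  -- n ≥ 2 / δ lets δn / 2 absorb the rounding error of ⌊λn⌋.
  let δ : ℝ := ρ * ε ^ 2 / (2 * (σ ^ 2 + 1))
  have hδ : 0 < δ := by positivity
  have h1 := hNlim (δ / 2) (half_pos hδ)
  obtain ⟨K, hK⟩ := eventually_atTop.1 (((tendsto_order.1 h1).2 (ρ / 2) (half_pos hρ)).and
    ((tendsto_natCast_atTop_atTop (R := ℝ)).eventually_ge_atTop (2 / δ)))
  refine ⟨K, fun n hnK => ?_⟩
  obtain ⟨hn1, hn2⟩ := hK n hnK.le
  have hn : (0 : ℝ) < n := lt_of_lt_of_le (by positivity) hn2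
  have hsqrt : 0 < √(n : ℝ) := Real.sqrt_pos.2 hn
  rw [Real.dist_0_eq_abs, abs_of_nonneg measureReal_nonneg]
  have hmain := measureReal_le_abs_randomSum_sub_sum hindep hident hsq hmean hvar (hN n)
    (hξN n) ⌊lam * n⌋₊ (d := δ * n) (c := ε * √(n : ℝ)) (by positivity) (by positivity)
  have hset : {ω | ε ≤ ‖(√(n : ℝ))⁻¹ * (∑ k ∈ Finset.range (N n ω), ξ k ω
      - ∑ k ∈ Finset.range ⌊lam * n⌋₊, ξ k ω) - 0‖}
      = {ω | ε * √(n : ℝ) ≤ |∑ k ∈ Finset.range (N n ω), ξ k ω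
        - ∑ k ∈ Finset.range ⌊lam * n⌋₊, ξ k ω|} := by
    ext ω
    simp only [Set.mem_ofPred_eq, sub_zero, Real.norm_eq_abs, abs_mul, abs_inv,
      abs_of_pos hsqrt]
    rw [inv_mul_eq_div, le_div_iff₀ hsqrt]
  rw [hset]
  have hsub : P.real {ω | δ * n < |(N n ω : ℝ) - (⌊lam * n⌋₊ : ℕ)|} ≤
      P.real {ω | δ / 2 ≤ ‖((N n ω : ℝ) - lam * n) / n - 0‖} := by
    refine measureReal_mono fun ω hω => ?_
    simp only [Set.mem_ofPred_eq, sub_zero, Real.norm_eq_abs, abs_div, abs_of_pos hn] at hω ⊢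
    rw [le_div_iff₀ hn]
    have h2 : 1 ≤ δ / 2 * n := by
      rw [div_le_iff₀ hδ] at hn2
      linarith
    have h3 : |lam * n - (⌊lam * n⌋₊ : ℝ)| ≤ 1 := by
      rw [abs_le]
      constructor
      · linarith [Nat.floor_le (show 0 ≤ lam * n by positivity)]
      · linarith [Nat.lt_floor_add_one (lam * n)]
    have h4 := abs_sub_le (N n ω : ℝ) (lam * n) (⌊lam * n⌋₊ : ℝ)
    linarith
  have hlast : δ * n * σ ^ 2 / (ε * √(n : ℝ)) ^ 2 < ρ / 2 := by
    rw [mul_pow, Real.sq_sqrt hn.le, div_lt_iff₀ (by positivity)]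
    have : δ * (2 * (σ ^ 2 + 1)) = ρ * ε ^ 2 := div_mul_cancel₀ _ (by positivity)
    have h5 : δ * n * σ ^ 2 < δ * n * (σ ^ 2 + 1) := by
      have : 0 < δ * n := by positivity
      nlinarith
    calc δ * n * σ ^ 2 < δ * n * (σ ^ 2 + 1) := h5
      _ = (δ * (2 * (σ ^ 2 + 1))) * n / 2 := by ring
      _ = ρ / 2 * (ε ^ 2 * n) := by rw [this]; ring
  linarith

/-- The central limit theorem along the indices `⌊λ n⌋`. -/
theorem tendstoInDistribution_sum_floor (hlam : 0 < lam) (hindep : iIndepFun ξ P)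
    (hident : ∀ k, IdentDistrib (ξ k) (ξ 0) P P) (hsq : MemLp (ξ 0) 2 P)
    (hmean : ∫ ω, ξ 0 ω ∂P = 0) (hvar : variance (ξ 0) P = σ ^ 2) {Z : Ω' → ℝ}
    (hZ : HasLaw Z (gaussianReal 0 1) P') :
    TendstoInDistribution (fun (n : ℕ) ω => (√(n : ℝ))⁻¹ * ∑ k ∈ Finset.range ⌊lam * n⌋₊, ξ k ω)
      atTop (fun ω => √lam * σ * Z ω) (fun _ => P) P' := by
  have hY : HasLaw (fun ω => σ * Z ω) (gaussianReal 0 (variance (ξ 0) P).toNNReal) P' := by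
    convert! gaussianReal_const_mul hZ σ using 2
    · simp
    · rw [hvar]
      ext
      simp [sq_nonneg]
  have h := tendstoInDistribution_inv_sqrt_mul_sum_sub hY hsq hindep hident
  simp only [hmean, mul_zero, sub_zero] at h
  have hfloor : Tendsto (fun n : ℕ => ⌊lam * (n : ℝ)⌋₊) atTop atTop :=
    tendsto_nat_floor_atTop.comp (tendsto_natCast_atTop_atTop.const_mul_atTop hlam)
  have hratio : Tendsto (fun n : ℕ => √((⌊lam * (n : ℝ)⌋₊ : ℝ) / n)) atTop (𝓝 (√lam)) :=
    (Real.continuous_sqrt.tendsto lam).comp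
      ((tendsto_nat_floor_mul_div_atTop hlam.le).comp tendsto_natCast_atTop_atTop)
  have h2 := (h.comp_tendsto hfloor).const_mul_of_tendsto hratio
  convert h2 using 2 with n
  · ext ω
    rcases Nat.eq_zero_or_pos ⌊lam * (n : ℝ)⌋₊ with h0 | h0
    · simp [h0]
    · have : 0 < √(⌊lam * (n : ℝ)⌋₊ : ℝ) := Real.sqrt_pos.2 (by exact_mod_cast h0)
      rw [Real.sqrt_div (Nat.cast_nonneg _)]
      field_simp
  · ring

end RandomSums

/-! ### A J₁-continuous functional controlling the η-sums -/

section Skorokhod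

/-- A continuous cutoff: `1` on `[0,T]` and `0` beyond `T + 1`. -/
noncomputable def skorokhodCutoff (T : ℝ) (s : ℝ≥0) : ℝ := max 0 (min 1 (T + 1 - s))

theorem skorokhodCutoff_nonneg (T : ℝ) (s : ℝ≥0) : 0 ≤ skorokhodCutoff T s := le_max_left _ _

theorem skorokhodCutoff_le_one (T : ℝ) (s : ℝ≥0) : skorokhodCutoff T s ≤ 1 :=
  max_le zero_le_one (min_le_left _ _)

theorem skorokhodCutoff_eq_one {T : ℝ} {s : ℝ≥0} (h : (s : ℝ) ≤ T) : skorokhodCutoff T s = 1 := by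
  rw [skorokhodCutoff, min_eq_left (by linarith), max_eq_right zero_le_one]

theorem skorokhodCutoff_eq_zero {T : ℝ} {s : ℝ≥0} (h : T + 1 ≤ (s : ℝ)) :
    skorokhodCutoff T s = 0 :=
  max_eq_left ((min_le_right _ _).trans (by linarith))

theorem abs_skorokhodCutoff_sub_le (T : ℝ) (s u : ℝ≥0) :
    |skorokhodCutoff T s - skorokhodCutoff T u| ≤ |(s : ℝ) - u| := by
  refine (abs_max_sub_max_le_max _ _ _ _).trans ?_
  rw [sub_self, abs_zero, max_eq_right (abs_nonneg _)]
  refine (abs_min_sub_min_le_max _ _ _ _).trans ?_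
  rw [sub_self, abs_zero, max_eq_right (abs_nonneg _), sub_sub_sub_cancel_left, abs_sub_comm]

namespace CadlagSpace

/-- The value of `x` at `s`, truncated and localized to `[0,T+1]`. -/
noncomputable def localizedValue (T : ℝ) (x : CadlagSpace) (s : ℝ≥0) : ℝ :=
  min 1 |x s| * skorokhodCutoff T s

/-- The truncated and localized supremum, a `J₁`-continuous functional. -/
noncomputable def localizedSup (T : ℝ) (x : CadlagSpace) : ℝ := ⨆ s, localizedValue T x s

theorem localizedValue_le_one (T : ℝ) (x : CadlagSpace) (s : ℝ≥0) : localizedValue T x s ≤ 1 :=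
  mul_le_one₀ (min_le_left _ _) (skorokhodCutoff_nonneg _ _) (skorokhodCutoff_le_one _ _)

theorem localizedValue_le_localizedSup (T : ℝ) (x : CadlagSpace) (s : ℝ≥0) :
    localizedValue T x s ≤ localizedSup T x :=
  le_ciSup (f := localizedValue T x) ⟨1, by rintro _ ⟨s, rfl⟩; exact localizedValue_le_one T x s⟩ s

theorem localizedSup_zero (T : ℝ) : localizedSup T 0 = 0 := by
  have h : ∀ s, localizedValue T 0 s = 0 := fun s => by
    have : (0 : CadlagSpace) s = 0 := rfl
    simp [localizedValue, this]
  simp [localizedSup, h]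

/-- Up to T', both factors are bounded by 1 and move by at most ε. Beyond T' ≥ T + 2, a time change
by less than 1 stays past T + 1, where the cutoff vanishes. A sharp cutoff at T would not be stable
under time changes. -/
theorem abs_localizedValue_sub_le {T ε : ℝ} {T' : ℝ≥0} (hT : T + 2 ≤ T') (hε1 : ε ≤ 1)
    {x y : CadlagSpace} {θ : ℝ≥0 ≃o ℝ≥0} (hθ : ∀ s : ℝ≥0, |(θ s : ℝ) - s| < ε)
    (hxy : ∀ s : ℝ≥0, s ≤ T' → |y (θ s) - x s| < ε) (s : ℝ≥0) :
    |localizedValue T y (θ s) - localizedValue T x s| ≤ 2 * ε := by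
  have hε : 0 < ε := (abs_nonneg _).trans_lt (hθ 0)
  rcases le_or_gt s T' with hs | hs
  · have h1 : abs (min 1 |y (θ s)| - min 1 |x s|) ≤ ε := by
      refine (abs_min_sub_min_le_max _ _ _ _).trans ?_
      rw [sub_self, abs_zero, max_eq_right (abs_nonneg _)]
      exact (abs_abs_sub_abs_le_abs_sub _ _).trans (hxy s hs).le
    have h2 : |skorokhodCutoff T (θ s) - skorokhodCutoff T s| ≤ ε :=
      (abs_skorokhodCutoff_sub_le _ _ _).trans (hθ s).le
    have h3 : abs (min 1 |x s|) ≤ 1 := by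
      rw [abs_of_nonneg (le_min zero_le_one (abs_nonneg _))]
      exact min_le_left _ _
    have h4 : |skorokhodCutoff T (θ s)| ≤ 1 := by
      rw [abs_of_nonneg (skorokhodCutoff_nonneg _ _)]
      exact skorokhodCutoff_le_one _ _
    calc |localizedValue T y (θ s) - localizedValue T x s|
        = abs ((min 1 |y (θ s)| - min 1 |x s|) * skorokhodCutoff T (θ s)
          + min 1 |x s| * (skorokhodCutoff T (θ s) - skorokhodCutoff T s)) := by
          rw [localizedValue, localizedValue]
          ring_nf
      _ ≤ ε * 1 + 1 * ε := by
          refine (abs_add_le _ _).trans ?_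
          rw [abs_mul, abs_mul]
          gcongr
      _ = 2 * ε := by ring
  · have hs' : (T' : ℝ) < s := by exact_mod_cast hs
    have h1 := (abs_lt.1 (hθ s)).1
    rw [localizedValue, localizedValue, skorokhodCutoff_eq_zero (s := s) (by linarith),
      skorokhodCutoff_eq_zero (s := θ s) (by linarith)]
    simp [hε.le]

theorem abs_localizedSup_sub_le {T ε : ℝ} {T' : ℝ≥0} (hT : T + 2 ≤ T') (hε1 : ε ≤ 1)
    {x y : CadlagSpace} (hy : y ∈ skorokhodNhd x T' ε) :
    |localizedSup T y - localizedSup T x| ≤ 2 * ε := by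
  obtain ⟨θ, hθ, hxy⟩ := hy
  have h := abs_localizedValue_sub_le hT hε1 hθ hxy
  rw [abs_sub_le_iff]
  constructor
  · rw [sub_le_iff_le_add]
    refine ciSup_le fun s => ?_
    -- Surjectivity of θ makes the supremum over θ(s) the full supremum.
    have h1 := (abs_sub_le_iff.1 (h (θ.symm s))).1
    rw [θ.apply_symm_apply] at h1
    linarith [localizedValue_le_localizedSup T x (θ.symm s)]
  · rw [sub_le_iff_le_add]
    refine ciSup_le fun s => ?_
    linarith [(abs_sub_le_iff.1 (h s)).2, localizedValue_le_localizedSup T y (θ s)]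

theorem continuous_localizedSup (T : ℝ) : Continuous (localizedSup T) := by
  refine continuous_def.2 fun U hU x hx => ?_
  obtain ⟨ε, hε, hball⟩ := Metric.isOpen_iff.1 hU _ hx
  refine ⟨Real.toNNReal (T + 2), min 1 (ε / 3), by positivity, fun y hy => hball ?_⟩
  rw [Metric.mem_ball, Real.dist_eq]
  have h1 := abs_localizedSup_sub_le (Real.le_coe_toNNReal (T + 2)) (min_le_left _ _) hy
  have h2 := min_le_right 1 (ε / 3)
  linarith

theorem ofSeq_div (a : ℕ → ℝ) {n : ℕ} (hn : 0 < n) (m : ℕ) :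
    ofSeq a n ((m : ℝ≥0) / n) = a m := by
  have hn' : (n : ℝ≥0) ≠ 0 := by exact_mod_cast hn.ne'
  change a ⌊(n : ℝ≥0) * ((m : ℝ≥0) / n)⌋₊ = a m
  rw [mul_div_cancel₀ _ hn', Nat.floor_natCast]

/-- The step function takes the value a_m at time m/n ≤ T, where the cutoff equals 1. As m is
arbitrary in this range, it may be random. -/
theorem min_one_abs_le_localizedSup_ofSeq (a : ℕ → ℝ) {n m : ℕ} {T : ℝ} (hn : 0 < n)
    (hm : (m : ℝ) ≤ T * n) : min 1 |a m| ≤ localizedSup T (ofSeq a n) := by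
  have hn' : (0 : ℝ) < n := by exact_mod_cast hn
  have h := localizedValue_le_localizedSup T (ofSeq a n) ((m : ℝ≥0) / n)
  rwa [localizedValue, ofSeq_div a hn, skorokhodCutoff_eq_one, mul_one] at h
  push_cast
  rwa [div_le_iff₀ hn']

end CadlagSpace

variable {Ω : Type*} [MeasurableSpace Ω] {P : Measure Ω} [IsProbabilityMeasure P]

/-- Weak convergence to `0` in the `J₁` topology makes the partial sums up to a random index of
linear growth negligible. -/
theorem tendstoInMeasure_randomSum_of_partialSumProcess {η : ℕ → Ω → ℝ}
    (hη : TendstoInDistribution (fun n : ℕ => partialSumProcess η n) atTop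
      (fun _ : Ω => (0 : CadlagSpace)) (fun _ => P) P) {N : ℕ → Ω → ℕ} {lam : ℝ}
    (hNlim : TendstoInMeasure P (fun n ω => ((N n ω : ℝ) - lam * n) / n) atTop (fun _ => 0)) :
    TendstoInMeasure P (fun (n : ℕ) ω => (n : ℝ) ^ (-(1 / 2) : ℝ)
      * ∑ k ∈ Finset.Icc 1 (N n ω), η k ω) atTop (fun _ => 0) := by
  -- Outside the unlikely event |N(n)/n - λ| ≥ 1, the index N(n) is at most (λ + 1)n.
  let T : ℝ := lam + 1
  have hcont := CadlagSpace.continuous_localizedSup T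
  have h1 := hη.continuous_comp hcont
  have h0 : CadlagSpace.localizedSup T ∘ (fun _ : Ω => (0 : CadlagSpace)) = fun _ => 0 :=
    funext fun _ => CadlagSpace.localizedSup_zero T
  rw [h0] at h1
  rw [tendstoInMeasure_iff_measureReal_norm] at hNlim ⊢
  intro ε hε
  -- The functional is truncated at 1, hence the minimum; the half gives a strict inequality.
  have hpos : 0 < min 1 ε / 2 := by positivity
  have h2 := h1.tendsto_measure_gt (a := fun _ => min 1 ε / 2) tendsto_const_nhds
    (by simp [hpos.ne])
  have h3 := h2.add (hNlim 1 one_pos)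
  have h4 : {_ω : Ω | min 1 ε / 2 < 0} = ∅ := by
    ext ω
    simp [hpos.le]
  rw [h4, measureReal_empty, add_zero] at h3
  refine squeeze_zero' (.of_forall fun n => measureReal_nonneg) ?_ h3
  filter_upwards [eventually_gt_atTop 0] with n hn
  have hn' : (0 : ℝ) < n := by exact_mod_cast hn
  refine (measureReal_mono ?_).trans (measureReal_union_le _ _)
  intro ω hω
  simp only [Set.mem_ofPred_eq, sub_zero, Real.norm_eq_abs, Set.mem_union] at hω ⊢
  by_contra! hcon
  obtain ⟨hc1, hc2⟩ := hcon
  rw [abs_div, abs_of_pos hn', div_lt_one hn'] at hc2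
  have hNT : (N n ω : ℝ) ≤ T * n := by
    simp only [T]
    linarith [(abs_lt.1 hc2).2]
  have h5 := CadlagSpace.min_one_abs_le_localizedSup_ofSeq
    (fun m => (n : ℝ) ^ (-(1 / 2) : ℝ) * ∑ k ∈ Finset.Icc 1 m, η k ω) hn hNT
  have h6 : min 1 ε ≤ min 1 |(n : ℝ) ^ (-(1 / 2) : ℝ) * ∑ k ∈ Finset.Icc 1 (N n ω), η k ω| :=
    min_le_min_left _ hω
  have h7 := h6.trans (h5.trans hc1)
  linarith

end Skorokhod

/-! ### Decomposition of the price and the two regimes -/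

section Assembly

theorem sum_Icc_one_eq_sum_range {α : Type*} [AddCommMonoid α] (f : ℕ → α) (m : ℕ) :
    ∑ k ∈ Finset.Icc 1 m, f k = ∑ k ∈ Finset.range m, f (k + 1) := by
  induction m with
  | zero => simp
  | succ m ih => rw [Finset.sum_Icc_succ_top (by omega), ih, Finset.sum_range_succ]

theorem inv_sqrt_natCast (n : ℕ) : (√(n : ℝ))⁻¹ = (n : ℝ) ^ (-(1 / 2) : ℝ) := by
  rw [Real.sqrt_eq_rpow, Real.rpow_neg (Nat.cast_nonneg n)]

theorem logPrice_sub {Ω : Type*} (μ lam : ℝ) (t : ℤ → Ω → ℝ) (e η : ℕ → Ω → ℝ) (n : ℕ) (ω : Ω) :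
    logPrice μ t e η (n : ℝ) ω - lam * μ * n = μ * (countingProcess t (n : ℝ) ω - lam * n)
      + ∑ k ∈ Finset.range (countingProcess t (n : ℝ) ω), e (k + 1) ω
      + ∑ k ∈ Finset.Icc 1 (countingProcess t (n : ℝ) ω), η k ω := by
  rw [logPrice, Finset.sum_add_distrib, sum_Icc_one_eq_sum_range fun k => e k ω]
  ring

variable {Ω Ω' Ω'' : Type*} [MeasurableSpace Ω] {P : Measure Ω} [IsProbabilityMeasure P]
  [MeasurableSpace Ω'] {P' : Measure Ω'} [IsProbabilityMeasure P']
  [MeasurableSpace Ω''] {P'' : Measure Ω''} [IsProbabilityMeasure P'']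

theorem MeasureTheory.TendstoInDistribution.of_identDistrib {X : ℕ → Ω → ℝ} {Z : Ω' → ℝ}
    {Z' : Ω'' → ℝ} (h : TendstoInDistribution X atTop Z (fun _ => P) P')
    (hZ : IdentDistrib Z' Z P'' P') :
    TendstoInDistribution X atTop Z' (fun _ => P) P'' := by
  refine ⟨h.forall_aemeasurable, hZ.aemeasurable_fst, ?_⟩
  have heq : (⟨P''.map Z', Measure.isProbabilityMeasure_map hZ.aemeasurable_fst⟩ :
      ProbabilityMeasure ℝ)
      = ⟨P'.map Z, Measure.isProbabilityMeasure_map h.aemeasurable_limit⟩ :=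
    Subtype.ext hZ.map_eq
  rw [heq]
  exact h.tendsto

theorem tendstoInMeasure_countingProcess_div {t : ℤ → Ω → ℝ} {lam γ : ℝ} {B : Ω' → ℝ}
    (hγ1 : γ < 1)
    (hV : TendstoInDistribution
      (fun (n : ℕ) (ω : Ω) => (n : ℝ) ^ (-γ) * (countingProcess t (n : ℝ) ω - lam * n))
      atTop B (fun _ => P) P') :
    TendstoInMeasure P (fun (n : ℕ) ω => ((countingProcess t (n : ℝ) ω : ℝ) - lam * n) / n) atTop
      (fun _ => 0) := by
  refine (hV.tendstoInMeasure_mul_zero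
    (tendsto_natCast_rpow_neg (r := 1 - γ) (by linarith))).congr_left fun n => ?_
  refine .of_forall fun ω => ?_
  -- At n = 0 both sides are 0 by the conventions for division by zero and for powers of 0.
  rcases Nat.eq_zero_or_pos n with rfl | hn
  · simp [Real.zero_rpow (show γ - 1 ≠ 0 by linarith)]
  · have hn' : (0 : ℝ) < n := by exact_mod_cast hn
    simp only
    rw [← mul_assoc, ← Real.rpow_add hn', show -(1 - γ) + -γ = -1 by ring, Real.rpow_neg_one,
      inv_mul_eq_div]

theorem measurable_logPrice {α : Type*} [MeasurableSpace α] {t : ℤ → α → ℝ} {e η : ℕ → α → ℝ}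
    (ht : ∀ k, Measurable (t k))
    (he : ∀ k, 1 ≤ k → Measurable (e k)) (hη : ∀ k, 1 ≤ k → Measurable (η k)) (μ s : ℝ) :
    Measurable (logPrice μ t e η s) := by
  have hN := measurable_countingProcess ht s
  have h1 : Measurable fun ω => (countingProcess t s ω : ℝ) :=
    (measurable_from_top (f := fun k : ℕ => (k : ℝ))).comp hN
  have h2 := measurable_randomSum (ζ := fun k ω => e (k + 1) ω + η (k + 1) ω)
    (fun k => (he _ (by omega)).add (hη _ (by omega))) hN
  convert! (h1.const_mul μ).add h2 using 1
  funext ω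
  simp only [logPrice, sum_Icc_one_eq_sum_range, Pi.add_apply]

end Assembly

theorem theorem2 {Ω : Type*} [MeasurableSpace Ω] (P : Measure Ω) [IsProbabilityMeasure P]
    {Ω₁ : Type*} [MeasurableSpace Ω₁] (P₁ : Measure Ω₁) [IsProbabilityMeasure P₁]
    (μ σe lam γ : ℝ) (hμ : μ ≠ 0) (hσe : 0 ≤ σe) (hlam : 0 < lam)
    (hγ : 1 / 2 ≤ γ) (hγ1 : γ < 1)
    (t : ℤ → Ω → ℝ) (ht : IsPointSequence P t)
    (e η : ℕ → Ω → ℝ)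
    (he_meas : ∀ k : ℕ, 1 ≤ k → Measurable (e k))
    (he_indep : iIndepFun (fun k : ℕ => e (k + 1)) P)
    (he_ident : ∀ k : ℕ, 1 ≤ k → IdentDistrib (e k) (e 1) P P)
    (he_sq : MemLp (e 1) 2 P)
    (he_mean : ∫ ω, e 1 ω ∂P = 0)
    (he_var : variance (e 1) P = σe ^ 2)
    (heN : IndepFun (fun ω (k : ℕ) => e (k + 1) ω)
      (fun ω (s : ℝ≥0) => countingProcess t (s : ℝ) ω) P)
    (hη_meas : ∀ k : ℕ, 1 ≤ k → Measurable (η k))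
    (hη : TendstoInDistribution (fun n : ℕ => partialSumProcess η n) atTop
      (fun _ : Ω => (0 : CadlagSpace)) (fun _ => P) P)
    (A : Ω₁ → ℝ) (hA : ¬ A =ᵐ[P₁] 0)
    (hτ : TendstoInDistribution
      (fun (n : ℕ) (ω : Ω) =>
        (n : ℝ) ^ (-γ) * ∑ k ∈ Finset.Icc 1 n, (duration t (k : ℤ) ω - 1 / lam))
      atTop A (fun _ => P) P₁) :
    (1 / 2 < γ →
      TendstoInDistribution
        (fun (n : ℕ) (ω : Ω) => (n : ℝ) ^ (-γ) * (logPrice μ t e η (n : ℝ) ω - lam * μ * n))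
        atTop (fun ω₁ => -μ * lam ^ (1 + γ) * A ω₁) (fun _ => P) P₁) ∧
    (γ = 1 / 2 →
      ∀ {Ω₂ : Type*} [MeasurableSpace Ω₂] (P₂ : Measure Ω₂) [IsProbabilityMeasure P₂]
        (A' Z : Ω₂ → ℝ), IdentDistrib A' A P₂ P₁ → HasLaw Z (gaussianReal 0 1) P₂ →
        IndepFun A' Z P₂ →
        TendstoInDistribution
          (fun (n : ℕ) (ω : Ω) =>
            (n : ℝ) ^ (-(1 / 2) : ℝ) * (logPrice μ t e η (n : ℝ) ω - lam * μ * n))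
          atTop
          (fun ω₂ => -μ * lam ^ (3 / 2 : ℝ) * A' ω₂ + Real.sqrt lam * σe * Z ω₂)
          (fun _ => P) P₂) := by

  have hγ0 : 0 < γ := by linarith
  have hV := tendstoInDistribution_countingProcess ht hlam hγ0 hγ1
    (tendstoInDistribution_points ht hγ0 hτ)
  have hNlim := tendstoInMeasure_countingProcess_div hγ1 hV
  have hNmeas : ∀ n : ℕ, Measurable (countingProcess t (n : ℝ)) := fun n =>
    measurable_countingProcess ht.measurable n
  have hξmeas : ∀ k : ℕ, Measurable (e (k + 1)) := fun k => he_meas _ (by omega)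
  have hξident : ∀ k : ℕ, IdentDistrib (e (k + 1)) (e (0 + 1)) P P := fun k =>
    he_ident _ (by omega)
  have hξN : ∀ n : ℕ, IndepFun (fun ω (k : ℕ) => e (k + 1) ω) (countingProcess t (n : ℝ)) P :=
    fun n => heN.comp measurable_id (measurable_pi_apply (n : ℝ≥0))
  have hηlim := tendstoInMeasure_randomSum_of_partialSumProcess hη hNlim
  have hsub := tendstoInMeasure_randomSum_sub hlam he_indep hξident he_sq he_mean he_var
    hNmeas hξN hNlim
  have hy : ∀ (r : ℝ) (n : ℕ), AEMeasurable
      (fun ω => r * (logPrice μ t e η (n : ℝ) ω - lam * μ * n)) P := fun r n =>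
    (((measurable_logPrice ht.measurable he_meas hη_meas μ n).sub_const _).const_mul r).aemeasurable
  refine ⟨fun hγ2 => ?_, fun hγ2 => ?_⟩
  · have hclt := tendstoInDistribution_sum_floor (P' := gaussianReal 0 1) (Z := id) hlam he_indep
      hξident he_sq he_mean he_var HasLaw.id
    have hsum := tendstoInDistribution_of_tendstoInMeasure_sub
      (fun (n : ℕ) ω => (√(n : ℝ))⁻¹
        * ∑ k ∈ Finset.range (countingProcess t (n : ℝ) ω), e (k + 1) ω) _ hclt
      (by
        refine hsub.congr_left fun n => .of_forall fun ω => ?_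
        simp only [Pi.sub_apply]
        ring)
      (fun n => ((measurable_randomSum hξmeas (hNmeas n)).const_mul _).aemeasurable)
    -- The surplus factor n^{-(γ - 1/2)} kills any sequence converging in distribution under the
    -- scaling n^{-1/2}.
    have hsmall := tendsto_natCast_rpow_neg (r := γ - 1 / 2) (by linarith)
    have hR1 := hsum.tendstoInMeasure_mul_zero hsmall
    have hR2 := (hηlim.tendstoInDistribution_of_aemeasurable (fun n => by
      have h := (measurable_randomSum (ζ := fun k => η (k + 1)) (fun k => hη_meas _ (by omega))
        (hNmeas n)).const_mul ((n : ℝ) ^ (-(1 / 2) : ℝ))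
      simpa only [sum_Icc_one_eq_sum_range] using h.aemeasurable)
      aemeasurable_const).tendstoInMeasure_mul_zero hsmall
    have hμV := hV.const_mul_of_tendsto (a := fun _ => μ) tendsto_const_nhds
    refine tendstoInDistribution_of_tendstoInMeasure_sub (X := fun (n : ℕ) ω =>
      μ * ((n : ℝ) ^ (-γ) * (countingProcess t (n : ℝ) ω - lam * n))) _ _ ?_
      ((hR1.add_of_zero hR2).congr_left fun n => .of_forall fun ω => ?_) (fun n => hy _ n)
    · convert hμV using 2
      ring
    · have hpow : (n : ℝ) ^ (-γ) = (n : ℝ) ^ (-(γ - 1 / 2)) * (n : ℝ) ^ (-(1 / 2) : ℝ) := by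
        rcases Nat.eq_zero_or_pos n with rfl | hn
        · rw [Nat.cast_zero, Real.zero_rpow (by linarith), Real.zero_rpow (by linarith), zero_mul]
        · rw [← Real.rpow_add (by exact_mod_cast hn)]
          congr 1
          ring
      simp only [Pi.sub_apply, logPrice_sub, inv_sqrt_natCast]
      rw [hpow]
      ring
  · subst hγ2
    intro Ω₂ _ P₂ _ A' Z hA' hZ hA'Z
    have hclt := tendstoInDistribution_sum_floor hlam he_indep hξident he_sq he_mean he_var hZ
    have hV' := (tendstoInDistribution_countingProcess ht hlam hγ0 hγ1
      ((tendstoInDistribution_points ht hγ0 hτ).of_identDistrib hA')).const_mul_of_tendsto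
        (a := fun _ => μ) tendsto_const_nhds
    -- Independence holds exactly for each n because the e-sum now stops at the deterministic index
    -- ⌊λn⌋ and the other term is a function of N(n).
    have hjoint := hV'.add_of_indepFun hclt (fun n => by
      refine ((hξN n).comp
        (φ := fun x : ℕ → ℝ => (√(n : ℝ))⁻¹ * ∑ k ∈ Finset.range ⌊lam * n⌋₊, x k)
        (ψ := fun m : ℕ => μ * ((n : ℝ) ^ (-(1 / 2) : ℝ) * ((m : ℝ) - lam * n)))
        (by fun_prop) measurable_from_top).symm)
      (hA'Z.comp (φ := fun a => μ * (-lam ^ (1 + 1 / 2 : ℝ) * a))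
        (ψ := fun z => √lam * σe * z) (by fun_prop) (by fun_prop))
    refine tendstoInDistribution_of_tendstoInMeasure_sub (X := fun (n : ℕ) ω =>
      μ * ((n : ℝ) ^ (-(1 / 2) : ℝ) * (countingProcess t (n : ℝ) ω - lam * n))
        + (√(n : ℝ))⁻¹ * ∑ k ∈ Finset.range ⌊lam * n⌋₊, e (k + 1) ω) _ _ ?_
      ((hsub.add_of_zero hηlim).congr_left fun n => .of_forall fun ω => ?_) (fun n => hy _ n)
    · convert hjoint using 2
      rw [show (1 + 1 / 2 : ℝ) = 3 / 2 by norm_num]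
      ring
    · simp only [Pi.sub_apply, logPrice_sub, inv_sqrt_natCast]
      ring
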